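/- For $c,D>0$, $r\ge 0$ put $\Delta_r(\eta)=c\eta^3+D\eta^2-c\eta+e^{-\eta r}$, so that $\Delta_0(\eta)=c\eta^3+D\eta^2-c\eta+1$. Let $\Gamma$ be the set of continuous nondecreasing $\varphi:\mathbb R\to\mathbb R$ with $\varphi(-\infty)=0$ and $\varphi(+\infty)=1$. Let $N_r[\varphi](\xi)=c\varphi'''(\xi)+D\varphi''(\xi)-c\varphi'(\xi)+\varphi(\xi-r)(1-\varphi(\xi))$. A function $\varphi\in C^1(\mathbb R)$ with $\varphi,\varphi'$ bounded is a quasi upper (resp. quasi lower) solution of $N_r[\varphi]=0$ if there is a finite set $T\subset\mathbb R$ such that on $\mathbb R\setminus T$ the derivatives $\varphi'',\varphi'''$ exist, are bounded, are absolutely continuous on compact intervals, and $N_r[\varphi]\le 0$ (resp. $\ge0$). **Corollary 4.1.** Let $c,D>0$ be such that $\Delta_0$ has two positive real roots $0<\lambda_1<\lambda_2$, and let $0<\varepsilon<\lambda_1$ with $\lambda_1+\varepsilon<\lambda_2$. Then there is $r_0>0$ such that for every delay $\tau\ge0$ with $r:=c\tau\le r_0$ the following hold. (a) $\Delta_r$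 has exactly two positive roots $\eta_1<\eta_2$; moreover $\eta_1+\varepsilon<\eta_2$ and $\Delta_r(\eta_1+\varepsilon)<0$. (b) The function $\overline\phi(\xi)=\tfrac12e^{\eta_1\xi}$ for $\xi<0$, $\overline\phi(\xi)=1-\tfrac12e^{-\eta_1\xi}$ for $\xi\ge0$, belongs to $\Gamma$ and is a quasi upper solution of $N_r[\varphi]=0$. (c) There is $q_0>0$ such that for every $q\ge q_0$ there is $\xi_1<0$ for which $d_1:=\tfrac12(1-qe^{\varepsilon\xi_1})e^{\eta_1\xi_1}\in(0,1)$, the function $\underline\phi(\xi)=\tfrac12(1-qe^{\varepsilon\xi})e^{\eta_1\xi}$ for $\xi<\xi_1$, $\underline\phi(\xi)=d_1$ for $\xi\ge\xi_1$, is a quasi lower solution of $N_r[\varphi]=0$, and $0\le\underline\phi(\xi)\le\overline\phi(\xi)$ for all $\xi\in\mathbb R$. (d) There is a monotone traveling wave connecting $0$ and $1$: a function $\phi\in\Gamma\cap C^3(\mathbb R)$ with $N_r[\phi]=0$ on $\mathbb R$, so that $u(x,t)=\phi(x+ct)$ is a classical solution of $$u_t=Du_{xx}+u_{xxt}+u(x,t-\tau)\bigl(1-u(x,t)\bigr),\qquad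 x,t\in\mathbb R .$$ -/

import Mathlib

open Filter Topology

noncomputable section

/-- The characteristic function `Δ_r(η) = c η³ + D η² - c η + e^{-η r}` of the profile equation,
linearized at the equilibrium `0`.  For `r = 0` it is the cubic `c η³ + D η² - c η + 1`. -/
def charFun (c D r η : ℝ) : ℝ :=
  c * η ^ 3 + D * η ^ 2 - c * η + Real.exp (-(η * r))

/-- The left-hand side
`c φ'''(ξ) + D φ''(ξ) - c φ'(ξ) + φ(ξ - r) (1 - φ(ξ))` of the profile equation. -/
def profileOp (c D r : ℝ) (φ : ℝ → ℝ) (ξ : ℝ) : ℝ :=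
  c * iteratedDeriv 3 φ ξ + D * iteratedDeriv 2 φ ξ - c * deriv φ ξ + φ (ξ - r) * (1 - φ ξ)

/-- The set `Γ` of continuous nondecreasing functions with limit `0` at `-∞` and `1` at `+∞`. -/
def Gam : Set (ℝ → ℝ) :=
  {φ | Continuous φ ∧ Monotone φ ∧ Tendsto φ atBot (𝓝 0) ∧ Tendsto φ atTop (𝓝 1)}

/-- `φ` is bounded and `C¹` with bounded derivative. -/
def IsBC1 (φ : ℝ → ℝ) : Prop :=
  ContDiff ℝ 1 φ ∧ (∃ M, ∀ ξ, |φ ξ| ≤ M) ∧ ∃ M, ∀ ξ, |deriv φ ξ| ≤ M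

/-- The regularity required of quasi upper and quasi lower solutions away from the finite
exceptional set `T`: the derivatives `φ''`, `φ'''` exist, are absolutely continuous on every
compact interval that does not meet `T`, and are bounded off `T`. -/
structure PiecewiseRegular (T : Finset ℝ) (φ : ℝ → ℝ) : Prop where
  diff_one : ∀ ξ, ξ ∉ T → DifferentiableAt ℝ (deriv φ) ξ
  diff_two : ∀ ξ, ξ ∉ T → DifferentiableAt ℝ (iteratedDeriv 2 φ) ξ
  ac_two : ∀ a b : ℝ, a ≤ b → (∀ ξ ∈ Set.Icc a b, ξ ∉ T) →
    AbsolutelyContinuousOnInterval (iteratedDeriv 2 φ) a b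
  ac_three : ∀ a b : ℝ, a ≤ b → (∀ ξ ∈ Set.Icc a b, ξ ∉ T) →
    AbsolutelyContinuousOnInterval (iteratedDeriv 3 φ) a b
  bdd_two : ∃ M, ∀ ξ, ξ ∉ T → |iteratedDeriv 2 φ ξ| ≤ M
  bdd_three : ∃ M, ∀ ξ, ξ ∉ T → |iteratedDeriv 3 φ ξ| ≤ M

/-- Quasi upper solution of the profile equation. -/
def IsQuasiUpper (c D r : ℝ) (φ : ℝ → ℝ) : Prop :=
  IsBC1 φ ∧ ∃ T : Finset ℝ, PiecewiseRegular T φ ∧ ∀ ξ, ξ ∉ T → profileOp c D r φ ξ ≤ 0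

/-- Quasi lower solution of the profile equation. -/
def IsQuasiLower (c D r : ℝ) (φ : ℝ → ℝ) : Prop :=
  IsBC1 φ ∧ ∃ T : Finset ℝ, PiecewiseRegular T φ ∧ ∀ ξ, ξ ∉ T → 0 ≤ profileOp c D r φ ξ

/-- The explicit quasi upper solution. -/
def phiUpper (η ξ : ℝ) : ℝ :=
  if ξ < 0 then 1 / 2 * Real.exp (η * ξ) else 1 - 1 / 2 * Real.exp (-(η * ξ))

/-- The plateau value `d₁ = (1/2) (1 - q e^{ε ξ₁}) e^{η ξ₁}` of the explicit quasi lower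
solution. -/
def plateau (η ε q ξ₁ : ℝ) : ℝ :=
  1 / 2 * (1 - q * Real.exp (ε * ξ₁)) * Real.exp (η * ξ₁)

/-- The explicit quasi lower solution. -/
def phiLower (η ε q ξ₁ ξ : ℝ) : ℝ :=
  if ξ < ξ₁ then 1 / 2 * (1 - q * Real.exp (ε * ξ)) * Real.exp (η * ξ) else plateau η ε q ξ₁

/-- `φ` is a classical (`C³`) solution on `ℝ` of the profile equation. -/
def IsProfileSolution (c D r : ℝ) (φ : ℝ → ℝ) : Prop :=
  ContDiff ℝ 3 φ ∧ ∀ ξ, profileOp c D r φ ξ = 0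

/-- `u` is a classical (`C³`) solution, for all `x` and `t`, of
`u_t = D u_xx + u_xxt + u(x, t - τ) (1 - u(x, t))`. -/
def IsPDESolution (D τ : ℝ) (u : ℝ → ℝ → ℝ) : Prop :=
  ContDiff ℝ 3 (fun p : ℝ × ℝ => u p.1 p.2) ∧
  ∀ x t : ℝ,
    deriv (fun s => u x s) t
      = D * iteratedDeriv 2 (fun y => u y t) x
        + deriv (fun s => iteratedDeriv 2 (fun y => u y s) x) t
        + u x (t - τ) * (1 - u x t)

end

/-! Adding `φ` to both sides turns the profile equation into `(1 + c∂ - D∂² - c∂³) φ = 1 - (1 - φ)(1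
- φ(· - r))`, whose right-hand side is monotone in `φ` on functions with values in `[0, 1]`. A
positive root of `Δ_0` forces the cubic symbol on the left to split over the reals as `∏ (1 - θᵢ η)`
(`exists_resolvent_params`). Each inverse `(1 - θ∂)⁻¹` is an average over an exponentially
distributed translation, whatever the sign of `θ`, so it preserves order, monotonicity, constants
and translations. Profiles are therefore the fixed points of an order-preserving map, `profileMap`.

Exponentials are eigenfunctions of these averages, and `∏ (1 - θᵢ η) = 1 + e^{-ηr} - Δ_r(η)`. Hence
a root `η` of `Δ_r` makes `e^{ηx}` an upper barrier, and `Δ_r(μ) < 0` with `η < μ ≤ 2η` makes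
`e^{ηx} - q e^{μx}` a lower barrier for large `q`. Iteration from `min(e^{ηx}, 1)` decreases
pointwise to a nonzero fixed point (`exists_profileMap_fixed`). Its limit `l` at `+∞` satisfies `l =
1 - (1 - l)²`, so `l = 1`. No compactness argument is needed, and the piecewise quasi solutions of
(b) and (c) play no role in the existence proof; they are checked directly.

Strict convexity of `Δ_r` on `[0, ∞)` and `Δ_r ≤ Δ_0` there control the roots: lowering the function
moves `η₁` left and `η₂` right, so the gap survives. Smallness of `r` serves only to keep `η₁ > ε`
and `r ≤ 2Dη₁`. -/

section Averages

/-! ### Exponential averages as positive resolvents. -/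

open MeasureTheory

/-- The average of `h (ξ + θ s)` over an exponentially distributed `s`: the resolvent
`(1 - θ ∂)⁻¹ h`. -/
noncomputable def expAvg (θ : ℝ) (h : ℝ → ℝ) (ξ : ℝ) : ℝ :=
  ∫ s in Set.Ioi (0 : ℝ), Real.exp (-s) * h (ξ + θ * s)

/-- Monotone functions with values in the unit interval. -/
def UnitMono (h : ℝ → ℝ) : Prop :=
  Monotone h ∧ ∀ x, 0 ≤ h x ∧ h x ≤ 1

theorem UnitMono.abs_le {h : ℝ → ℝ} (hh : UnitMono h) (x : ℝ) : |h x| ≤ 1 := by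
  rw [_root_.abs_le]; constructor <;> linarith [(hh.2 x).1, (hh.2 x).2]

theorem integrableOn_exp_neg_mul {g : ℝ → ℝ} (hg : Measurable g) (hb : ∀ x, |g x| ≤ 1)
    (a : ℝ) : IntegrableOn (fun s => Real.exp (-s) * g s) (Set.Ioi a) := by
  refine Integrable.mono' (integrableOn_exp_neg_Ioi a)
    ((by fun_prop : Measurable fun s => Real.exp (-s) * g s).aestronglyMeasurable) ?_
  refine Eventually.of_forall fun s => ?_
  rw [Real.norm_eq_abs, abs_mul, abs_of_pos (Real.exp_pos _)]
  exact mul_le_of_le_one_right (Real.exp_pos _).le (hb s)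

theorem UnitMono.integrableOn {h : ℝ → ℝ} (hh : UnitMono h) (θ ξ a : ℝ) :
    IntegrableOn (fun s => Real.exp (-s) * h (ξ + θ * s)) (Set.Ioi a) :=
  integrableOn_exp_neg_mul (g := fun s => h (ξ + θ * s))
    (hh.1.measurable.comp (by fun_prop)) (fun _ => hh.abs_le _) a

theorem exp_neg_mul_exp (θ η ξ s : ℝ) :
    Real.exp (-s) * Real.exp (η * (ξ + θ * s))
      = Real.exp (η * ξ) * Real.exp (-(1 - η * θ) * s) := by
  rw [← Real.exp_add, ← Real.exp_add]; ring_nf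

theorem integrableOn_exp_neg_mul_exp {θ η : ℝ} (h : 0 < 1 - η * θ) (ξ : ℝ) :
    IntegrableOn (fun s => Real.exp (-s) * Real.exp (η * (ξ + θ * s))) (Set.Ioi 0) := by
  simp only [exp_neg_mul_exp]
  exact (integrableOn_exp_mul_Ioi (by linarith) 0).const_mul _

theorem integral_exp_neg_mul_exp {θ η : ℝ} (h : 0 < 1 - η * θ) (ξ : ℝ) :
    ∫ s in Set.Ioi (0 : ℝ), Real.exp (-s) * Real.exp (η * (ξ + θ * s))
      = Real.exp (η * ξ) / (1 - η * θ) := by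
  simp only [exp_neg_mul_exp]
  rw [integral_const_mul, integral_exp_mul_Ioi (by linarith)]
  rw [mul_zero, Real.exp_zero, neg_div_neg_eq, mul_one_div]

theorem integrableOn_exp_neg_mul_two {θ η μ : ℝ} (h : 0 < 1 - η * θ) (h' : 0 < 1 - μ * θ)
    (A B ξ : ℝ) :
    IntegrableOn (fun s => Real.exp (-s) *
      (A * Real.exp (η * (ξ + θ * s)) + B * Real.exp (μ * (ξ + θ * s)))) (Set.Ioi 0) := by
  refine Integrable.congr (((integrableOn_exp_neg_mul_exp h ξ).const_mul A).add
    ((integrableOn_exp_neg_mul_exp h' ξ).const_mul B)) (Eventually.of_forall fun s => ?_)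
  simp only [Pi.add_apply]; ring

/-- Exponentials are eigenfunctions of the average, with eigenvalue `1 / (1 - ηθ)`; the sign
hypotheses are what makes the integrals converge. Two terms are exactly what the lower barrier
needs. -/
theorem expAvg_two {θ η μ : ℝ} (h : 0 < 1 - η * θ) (h' : 0 < 1 - μ * θ) (A B ξ : ℝ) :
    expAvg θ (fun x => A * Real.exp (η * x) + B * Real.exp (μ * x)) ξ
      = A / (1 - η * θ) * Real.exp (η * ξ) + B / (1 - μ * θ) * Real.exp (μ * ξ) := by
  unfold expAvg
  have : ∀ s : ℝ, Real.exp (-s) *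
      (A * Real.exp (η * (ξ + θ * s)) + B * Real.exp (μ * (ξ + θ * s)))
      = A * (Real.exp (-s) * Real.exp (η * (ξ + θ * s)))
        + B * (Real.exp (-s) * Real.exp (μ * (ξ + θ * s))) := fun s => by ring
  simp only [this]
  rw [integral_add ((integrableOn_exp_neg_mul_exp h ξ).const_mul A)
    ((integrableOn_exp_neg_mul_exp h' ξ).const_mul B), integral_const_mul, integral_const_mul,
    integral_exp_neg_mul_exp h, integral_exp_neg_mul_exp h']
  ring

theorem expAvg_le_two {θ η μ : ℝ} (h : 0 < 1 - η * θ) (h' : 0 < 1 - μ * θ) {A B : ℝ}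
    {u : ℝ → ℝ} (hu : UnitMono u)
    (hle : ∀ x, u x ≤ A * Real.exp (η * x) + B * Real.exp (μ * x)) (ξ : ℝ) :
    expAvg θ u ξ
      ≤ A / (1 - η * θ) * Real.exp (η * ξ) + B / (1 - μ * θ) * Real.exp (μ * ξ) := by
  rw [← expAvg_two h h']
  exact integral_mono (hu.integrableOn θ ξ 0) (integrableOn_exp_neg_mul_two h h' A B ξ)
    fun s => mul_le_mul_of_nonneg_left (hle _) (Real.exp_pos _).le

theorem two_le_expAvg {θ η μ : ℝ} (h : 0 < 1 - η * θ) (h' : 0 < 1 - μ * θ) {A B : ℝ}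
    {u : ℝ → ℝ} (hu : UnitMono u)
    (hle : ∀ x, A * Real.exp (η * x) + B * Real.exp (μ * x) ≤ u x) (ξ : ℝ) :
    A / (1 - η * θ) * Real.exp (η * ξ) + B / (1 - μ * θ) * Real.exp (μ * ξ)
      ≤ expAvg θ u ξ := by
  rw [← expAvg_two h h']
  exact integral_mono (integrableOn_exp_neg_mul_two h h' A B ξ) (hu.integrableOn θ ξ 0)
    fun s => mul_le_mul_of_nonneg_left (hle _) (Real.exp_pos _).le

theorem expAvg_mono {u v : ℝ → ℝ} (hu : UnitMono u) (hv : UnitMono v) (θ : ℝ)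
    (h : ∀ x, u x ≤ v x) (ξ : ℝ) : expAvg θ u ξ ≤ expAvg θ v ξ :=
  integral_mono (hu.integrableOn θ ξ 0) (hv.integrableOn θ ξ 0)
    fun _ => mul_le_mul_of_nonneg_left (h _) (Real.exp_pos _).le

theorem expAvg_const (θ k ξ : ℝ) : expAvg θ (fun _ => k) ξ = k := by
  unfold expAvg
  rw [integral_mul_const, integral_exp_neg_Ioi_zero, one_mul]

theorem unitMono_const {k : ℝ} (h0 : 0 ≤ k) (h1 : k ≤ 1) : UnitMono fun _ => k :=
  ⟨monotone_const, fun _ => ⟨h0, h1⟩⟩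

theorem UnitMono.shift {u : ℝ → ℝ} (hu : UnitMono u) (a : ℝ) : UnitMono fun x => u (x + a) :=
  ⟨fun _ _ h => hu.1 (by linarith), fun _ => hu.2 _⟩

theorem expAvg_shift (θ : ℝ) (u : ℝ → ℝ) (a ξ : ℝ) :
    expAvg θ (fun x => u (x + a)) ξ = expAvg θ u (ξ + a) := by
  unfold expAvg
  refine integral_congr_ae (Eventually.of_forall fun s => ?_)
  simp only [add_right_comm]

theorem UnitMono.expAvg {u : ℝ → ℝ} (hu : UnitMono u) (θ : ℝ) : UnitMono (expAvg θ u) := by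
  refine ⟨fun x y hxy => ?_, fun x => ⟨?_, ?_⟩⟩
  -- Monotonicity is comparison of `u` with its own translate by `y - x ≥ 0`.
  · have h := expAvg_mono hu (hu.shift (y - x)) θ (fun z => hu.1 (by linarith)) x
    rwa [expAvg_shift, add_sub_cancel] at h
  · have h := expAvg_mono (unitMono_const le_rfl zero_le_one) hu θ (fun z => (hu.2 z).1) x
    rwa [expAvg_const] at h
  · have h := expAvg_mono hu (unitMono_const zero_le_one le_rfl) θ (fun z => (hu.2 z).2) x
    rwa [expAvg_const] at h

theorem tendsto_expAvg {u : ℕ → ℝ → ℝ} {v : ℝ → ℝ} (hu : ∀ n, UnitMono (u n))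
    (h : ∀ x, Tendsto (fun n => u n x) atTop (𝓝 (v x))) (θ ξ : ℝ) :
    Tendsto (fun n => expAvg θ (u n) ξ) atTop (𝓝 (expAvg θ v ξ)) := by
  refine tendsto_integral_of_dominated_convergence (fun s => Real.exp (-s))
    (fun n => ((hu n).integrableOn θ ξ 0).aestronglyMeasurable) (integrableOn_exp_neg_Ioi 0)
    (fun n => Eventually.of_forall fun s => ?_)
    (Eventually.of_forall fun s => (h _).const_mul _)
  rw [Real.norm_eq_abs, abs_mul, abs_of_pos (Real.exp_pos _)]
  exact mul_le_of_le_one_right (Real.exp_pos _).le ((hu n).abs_le _)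

/-- Moving `ξ` from the integrand to the limit of integration lets a merely measurable `u` yield a
continuous average, and a continuous `u` a differentiable one. The substitution acts on `s`, so the
sign of `θ` does not matter. -/
theorem expAvg_eq_primitive {u : ℝ → ℝ} (hu : UnitMono u) {θ : ℝ} (hθ : θ ≠ 0) (ξ : ℝ) :
    expAvg θ u ξ = Real.exp (ξ / θ) *
      (expAvg θ u 0 - ∫ s in (0 : ℝ)..(ξ / θ), Real.exp (-s) * u (θ * s)) := by
  have hint : ∀ a, IntegrableOn (fun s => Real.exp (-s) * u (θ * s)) (Set.Ioi a) := fun a => by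
    simpa using hu.integrableOn θ 0 a
  have h0 : expAvg θ u 0 = ∫ s in Set.Ioi (0 : ℝ), Real.exp (-s) * u (θ * s) := by
    simp [expAvg]
  have h1 : expAvg θ u ξ
      = Real.exp (ξ / θ) * ∫ s in Set.Ioi (ξ / θ), Real.exp (-s) * u (θ * s) := by
    rw [← integral_const_mul]
    rw [← (measurePreserving_add_right volume (ξ / θ)).setIntegral_preimage_emb
      (measurableEmbedding_addRight (ξ / θ)), Set.preimage_add_const_Ioi, sub_self]
    unfold expAvg
    refine integral_congr_ae (Eventually.of_forall fun s => ?_)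
    have e : θ * (s + ξ / θ) = ξ + θ * s := by field_simp; ring
    simp only [e]
    rw [← mul_assoc, ← Real.exp_add]
    ring_nf
  rw [h1, h0, ← intervalIntegral.integral_Ioi_sub_Ioi' (hint 0) (hint _), sub_sub_cancel]

theorem continuous_expAvg {u : ℝ → ℝ} (hu : UnitMono u) {θ : ℝ} (hθ : θ ≠ 0) :
    Continuous (expAvg θ u) := by
  rw [funext (expAvg_eq_primitive hu hθ)]
  have hint : ∀ a b, IntervalIntegrable (fun s => Real.exp (-s) * u (θ * s)) volume a b :=
    fun a b => by
      have h : ∀ a, IntegrableOn (fun s => Real.exp (-s) * u (θ * s)) (Set.Ioi a) := fun a => by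
        simpa using hu.integrableOn θ 0 a
      exact ⟨(h a).mono_set Set.Ioc_subset_Ioi_self, (h b).mono_set Set.Ioc_subset_Ioi_self⟩
  have := (intervalIntegral.continuous_primitive hint 0).comp (continuous_id.div_const θ)
  exact (by fun_prop : Continuous fun ξ => Real.exp (ξ / θ)).mul (continuous_const.sub this)

theorem hasDerivAt_expAvg {u : ℝ → ℝ} (hu : UnitMono u) (huc : Continuous u) {θ : ℝ}
    (hθ : θ ≠ 0) (ξ : ℝ) :
    HasDerivAt (expAvg θ u) ((expAvg θ u ξ - u ξ) / θ) ξ := by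
  have hc : Continuous fun s => Real.exp (-s) * u (θ * s) := by fun_prop
  have hd : HasDerivAt (fun ξ : ℝ => ξ / θ) (1 / θ) ξ := (hasDerivAt_id ξ).div_const θ
  have h1 := (hc.integral_hasStrictDerivAt 0 (ξ / θ)).hasDerivAt.comp ξ hd
  have h2 := (Real.hasDerivAt_exp (ξ / θ)).comp ξ hd
  have h3 := h2.mul (h1.const_sub (expAvg θ u 0))
  rw [funext (expAvg_eq_primitive hu hθ)]
  refine h3.congr_deriv ?_
  simp only [Function.comp_def]
  rw [mul_div_cancel₀ _ hθ, Real.exp_neg]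
  field_simp
  ring

/-- Bootstrapping in `R' = (R - u) / θ`: each average gains one derivative over `u`. -/
theorem contDiff_expAvg {u : ℝ → ℝ} (hu : UnitMono u) {θ : ℝ} (hθ : θ ≠ 0) (n : ℕ)
    (h : ContDiff ℝ n u) : ContDiff ℝ (n + 1 : ℕ) (expAvg θ u) := by
  have hd := hasDerivAt_expAvg hu h.continuous hθ
  have hderiv : deriv (expAvg θ u) = fun ξ => (expAvg θ u ξ - u ξ) / θ :=
    funext fun ξ => (hd ξ).deriv
  have hdiff : Differentiable ℝ (expAvg θ u) := fun ξ => (hd ξ).differentiableAt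
  have step : ∀ m : ℕ, m ≤ n → ContDiff ℝ m (expAvg θ u) →
      ContDiff ℝ (m + 1 : ℕ) (expAvg θ u) := fun m hm hR => by
    rw [Nat.cast_add, Nat.cast_one, contDiff_succ_iff_deriv]
    refine ⟨hdiff, fun h => by simp at h, ?_⟩
    rw [hderiv]
    exact (hR.sub (h.of_le (by exact_mod_cast hm))).div_const θ
  have key : ∀ m : ℕ, m ≤ n + 1 → ContDiff ℝ m (expAvg θ u) := fun m => by
    induction m with
    | zero => intro _; exact contDiff_zero.2 (continuous_expAvg hu hθ)
    | succ m ih => intro hm; exact step m (by omega) (ih (by omega))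
  exact key _ le_rfl

/-! ### The order-preserving fixed-point map. -/

/-- The monotone nonlinearity `u + u(· - r) (1 - u)`. -/
def delayTerm (r : ℝ) (u : ℝ → ℝ) (ξ : ℝ) : ℝ := 1 - (1 - u ξ) * (1 - u (ξ - r))

theorem UnitMono.delayTerm {u : ℝ → ℝ} (hu : UnitMono u) (r : ℝ) :
    UnitMono (delayTerm r u) := by
  unfold _root_.delayTerm
  refine ⟨fun x y hxy => ?_, fun x => ?_⟩
  · have h1 := hu.1 hxy
    have h2 := hu.1 (by linarith : x - r ≤ y - r)
    have := mul_le_mul (by linarith : 1 - u y ≤ 1 - u x)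
      (by linarith : 1 - u (y - r) ≤ 1 - u (x - r)) (by linarith [(hu.2 (y - r)).2])
      (by linarith [(hu.2 x).2])
    simp only
    linarith
  · have h1 : 0 ≤ 1 - u x := by linarith [(hu.2 x).2]
    have h2 : 0 ≤ 1 - u (x - r) := by linarith [(hu.2 (x - r)).2]
    have h3 : 1 - u x ≤ 1 := by linarith [(hu.2 x).1]
    have h4 : 1 - u (x - r) ≤ 1 := by linarith [(hu.2 (x - r)).1]
    constructor
    · linarith [mul_le_one₀ h3 h2 h4]
    · linarith [mul_nonneg h1 h2]

theorem delayTerm_mono {u v : ℝ → ℝ} (hu : UnitMono u) (hv : UnitMono v) (r : ℝ)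
    (h : ∀ x, u x ≤ v x) (ξ : ℝ) : delayTerm r u ξ ≤ delayTerm r v ξ := by
  have := mul_le_mul (by linarith [h ξ] : 1 - v ξ ≤ 1 - u ξ)
    (by linarith [h (ξ - r)] : 1 - v (ξ - r) ≤ 1 - u (ξ - r))
    (by linarith [(hv.2 (ξ - r)).2]) (by linarith [(hu.2 ξ).2])
  unfold delayTerm
  linarith

/-- The integral operator whose fixed points are the profiles. -/
noncomputable def profileMap (θ₁ θ₂ θ₃ r : ℝ) (u : ℝ → ℝ) : ℝ → ℝ :=
  expAvg θ₁ (expAvg θ₂ (expAvg θ₃ (delayTerm r u)))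

theorem UnitMono.profileMap {u : ℝ → ℝ} (hu : UnitMono u) (θ₁ θ₂ θ₃ r : ℝ) :
    UnitMono (profileMap θ₁ θ₂ θ₃ r u) :=
  (((hu.delayTerm r).expAvg θ₃).expAvg θ₂).expAvg θ₁

theorem profileMap_mono {u v : ℝ → ℝ} (hu : UnitMono u) (hv : UnitMono v) (θ₁ θ₂ θ₃ r : ℝ)
    (h : ∀ x, u x ≤ v x) (ξ : ℝ) : profileMap θ₁ θ₂ θ₃ r u ξ ≤ profileMap θ₁ θ₂ θ₃ r v ξ :=
  expAvg_mono (((hu.delayTerm r).expAvg θ₃).expAvg θ₂) (((hv.delayTerm r).expAvg θ₃).expAvg θ₂) _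
    (expAvg_mono ((hu.delayTerm r).expAvg θ₃) ((hv.delayTerm r).expAvg θ₃) _
      (expAvg_mono (hu.delayTerm r) (hv.delayTerm r) _ (delayTerm_mono hu hv r h))) ξ

theorem tendsto_profileMap {u : ℕ → ℝ → ℝ} {v : ℝ → ℝ} (hu : ∀ n, UnitMono (u n))
    (h : ∀ x, Tendsto (fun n => u n x) atTop (𝓝 (v x))) (θ₁ θ₂ θ₃ r ξ : ℝ) :
    Tendsto (fun n => profileMap θ₁ θ₂ θ₃ r (u n) ξ) atTop (𝓝 (profileMap θ₁ θ₂ θ₃ r v ξ)) :=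
  tendsto_expAvg (fun n => (((hu n).delayTerm r).expAvg θ₃).expAvg θ₂)
    (tendsto_expAvg (fun n => ((hu n).delayTerm r).expAvg θ₃)
      (tendsto_expAvg (fun n => (hu n).delayTerm r)
        (fun x => (((h x).const_sub 1).mul ((h (x - r)).const_sub 1)).const_sub 1) _) _) _ _

theorem profileMap_const (θ₁ θ₂ θ₃ r k ξ : ℝ) :
    profileMap θ₁ θ₂ θ₃ r (fun _ => k) ξ = 1 - (1 - k) * (1 - k) := by
  have h1 : delayTerm r (fun _ => k) = fun _ => 1 - (1 - k) * (1 - k) := rfl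
  have h2 : ∀ θ m : ℝ, expAvg θ (fun _ => m) = fun _ => m := fun θ m =>
    funext (expAvg_const θ m)
  simp only [profileMap, h1, h2]

theorem profileMap_shift (θ₁ θ₂ θ₃ r : ℝ) (u : ℝ → ℝ) (a ξ : ℝ) :
    profileMap θ₁ θ₂ θ₃ r (fun x => u (x + a)) ξ = profileMap θ₁ θ₂ θ₃ r u (ξ + a) := by
  have h1 : delayTerm r (fun x => u (x + a)) = fun x => delayTerm r u (x + a) :=
    funext fun x => by simp only [delayTerm, sub_add_eq_add_sub]
  have h2 : ∀ θ (v : ℝ → ℝ), expAvg θ (fun x => v (x + a)) = fun x => expAvg θ v (x + a) :=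
    fun θ v => funext fun x => expAvg_shift θ v a x
  simp only [profileMap, h1, h2]

end Averages

/-! ### Exponential barriers and monotone iteration. -/

theorem UnitMono.of_tendsto {u : ℕ → ℝ → ℝ} {v : ℝ → ℝ} (hu : ∀ n, UnitMono (u n))
    (h : ∀ x, Tendsto (fun n => u n x) atTop (𝓝 (v x))) : UnitMono v :=
  ⟨fun x y hxy => le_of_tendsto_of_tendsto' (h x) (h y) fun n => (hu n).1 hxy, fun x =>
    ⟨ge_of_tendsto' (h x) fun n => ((hu n).2 x).1, le_of_tendsto' (h x) fun n => ((hu n).2 x).2⟩⟩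

/-- The polynomial `∏ (1 - θᵢ λ)`. -/
def resolventDenom (θ₁ θ₂ θ₃ l : ℝ) : ℝ := (1 - l * θ₃) * (1 - l * θ₂) * (1 - l * θ₁)

/-- Dropping the term `-u u(· - r)` leaves the linearization, which multiplies `e^{ηx}` by `1 +
e^{-ηr}`; the three averages divide by the same number. -/
theorem profileMap_le_exp {θ₁ θ₂ θ₃ r η : ℝ} {u : ℝ → ℝ} (hu : UnitMono u)
    (h₁ : 0 < 1 - η * θ₁) (h₂ : 0 < 1 - η * θ₂) (h₃ : 0 < 1 - η * θ₃)
    (hden : resolventDenom θ₁ θ₂ θ₃ η = 1 + Real.exp (-(η * r)))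
    (hle : ∀ x, u x ≤ Real.exp (η * x)) (ξ : ℝ) :
    profileMap θ₁ θ₂ θ₃ r u ξ ≤ Real.exp (η * ξ) := by
  have h0 : ∀ x, delayTerm r u x
      ≤ (1 + Real.exp (-(η * r))) * Real.exp (η * x) + 0 * Real.exp (η * x) := fun x => by
    have e : Real.exp (η * (x - r)) = Real.exp (-(η * r)) * Real.exp (η * x) := by
      rw [← Real.exp_add]; ring_nf
    have := hle (x - r)
    rw [e] at this
    have := mul_nonneg (hu.2 x).1 (hu.2 (x - r)).1
    unfold delayTerm
    linarith [hle x]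
  have key := expAvg_le_two h₁ h₁ (((hu.delayTerm r).expAvg θ₃).expAvg θ₂)
    (expAvg_le_two h₂ h₂ ((hu.delayTerm r).expAvg θ₃)
      (expAvg_le_two h₃ h₃ (hu.delayTerm r) h0)) ξ
  refine key.trans_eq ?_
  rw [← hden, resolventDenom]
  field_simp
  ring

/-- The discarded quadratic term costs at most `e^{2ηx} ≤ e^{μx}` for `x < 0`, which is why `μ ≤ 2η`
is needed; the extra `+ 1` in `hdenμ` pays for it. -/
theorem le_profileMap_exp {θ₁ θ₂ θ₃ r η μ q : ℝ} {u : ℝ → ℝ} (hu : UnitMono u) (hr : 0 ≤ r)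
    (hη : 0 < η) (hημ : η < μ) (hμ : μ ≤ 2 * η) (hq : 1 ≤ q)
    (h₁ : 0 < 1 - η * θ₁) (h₂ : 0 < 1 - η * θ₂) (h₃ : 0 < 1 - η * θ₃)
    (k₁ : 0 < 1 - μ * θ₁) (k₂ : 0 < 1 - μ * θ₂) (k₃ : 0 < 1 - μ * θ₃)
    (hden : resolventDenom θ₁ θ₂ θ₃ η = 1 + Real.exp (-(η * r)))
    (hdenμ : q * (1 + Real.exp (-(μ * r))) + 1 ≤ q * resolventDenom θ₁ θ₂ θ₃ μ)
    (hle : ∀ x, Real.exp (η * x) - q * Real.exp (μ * x) ≤ u x) (ξ : ℝ) :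
    Real.exp (η * ξ) - q * Real.exp (μ * ξ) ≤ profileMap θ₁ θ₂ θ₃ r u ξ := by
  have h0 : ∀ x, (1 + Real.exp (-(η * r))) * Real.exp (η * x)
      + (-(q * (1 + Real.exp (-(μ * r))) + 1)) * Real.exp (μ * x) ≤ delayTerm r u x := fun x => by
    have e : ∀ l : ℝ, Real.exp (l * (x - r)) = Real.exp (-(l * r)) * Real.exp (l * x) :=
      fun l => by rw [← Real.exp_add]; ring_nf
    have hx := hle x
    have hy := hle (x - r)
    rw [e, e] at hy
    have ux := hu.2 x
    have uy := hu.2 (x - r)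
    have hμx := Real.exp_pos (μ * x)
    have hμr := Real.exp_pos (-(μ * r))
    have hηx := Real.exp_pos (η * x)
    rcases le_or_gt 0 x with h | h
    -- For `x ≥ 0` the unshifted part `e^{ηx} - (q + 1) e^{μx}` is negative, so the bound on `u (x -
    -- r)` alone suffices.
    · have hle1 : Real.exp (η * x) ≤ Real.exp (μ * x) :=
        Real.exp_le_exp.2 (mul_le_mul_of_nonneg_right hημ.le h)
      have hq1 : Real.exp (μ * x) ≤ q * Real.exp (μ * x) := le_mul_of_one_le_left hμx.le hq
      have hD : u (x - r) ≤ delayTerm r u x := by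
        unfold delayTerm
        nlinarith [mul_nonneg ux.1 (sub_nonneg.2 uy.2)]
      nlinarith
    -- Truncating the barriers at `0` keeps both factors nonnegative, so that their product can be
    -- bounded by `e^{2ηx}`.
    · set a := max (Real.exp (η * x) - q * Real.exp (μ * x)) 0 with ha
      set b := max (Real.exp (-(η * r)) * Real.exp (η * x)
        - q * (Real.exp (-(μ * r)) * Real.exp (μ * x))) 0 with hb
      have ha1 : a ≤ u x := max_le hx ux.1
      have hb1 : b ≤ u (x - r) := max_le hy uy.1
      have ha0 : 0 ≤ a := le_max_right _ _
      have hb0 : 0 ≤ b := le_max_right _ _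
      have ha2 : a ≤ Real.exp (η * x) := max_le (by nlinarith) hηx.le
      have hr1 : Real.exp (-(η * r)) ≤ 1 := Real.exp_le_one_iff.2 (by nlinarith)
      have hb2 : b ≤ Real.exp (η * x) := by
        refine max_le ?_ hηx.le
        have := mul_le_of_le_one_left hηx.le hr1
        have : 0 ≤ q * (Real.exp (-(μ * r)) * Real.exp (μ * x)) := by positivity
        linarith
      have hab : a * b ≤ Real.exp (μ * x) := by
        refine (mul_le_mul ha2 hb2 hb0 hηx.le).trans ?_
        rw [← Real.exp_add]
        exact Real.exp_le_exp.2 (by nlinarith)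
      have hD : a + b - a * b ≤ delayTerm r u x := by
        have := mul_le_mul (by linarith : 1 - u x ≤ 1 - a) (by linarith : 1 - u (x - r) ≤ 1 - b)
          (by linarith) (by linarith)
        unfold delayTerm
        linarith
      have ha3 : Real.exp (η * x) - q * Real.exp (μ * x) ≤ a := le_max_left _ _
      have hb3 : Real.exp (-(η * r)) * Real.exp (η * x)
        - q * (Real.exp (-(μ * r)) * Real.exp (μ * x)) ≤ b := le_max_left _ _
      linarith
  have key := two_le_expAvg h₁ k₁ (((hu.delayTerm r).expAvg θ₃).expAvg θ₂)
    (two_le_expAvg h₂ k₂ ((hu.delayTerm r).expAvg θ₃)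
      (two_le_expAvg h₃ k₃ (hu.delayTerm r) h0)) ξ
  refine le_trans ?_ key
  have hpos : 0 < resolventDenom θ₁ θ₂ θ₃ μ := mul_pos (mul_pos k₃ k₂) k₁
  have e1 : (1 + Real.exp (-(η * r))) / (1 - η * θ₃) / (1 - η * θ₂) / (1 - η * θ₁) = 1 := by
    rw [← hden, resolventDenom]; field_simp
  have e2 : -(q * (1 + Real.exp (-(μ * r))) + 1) / (1 - μ * θ₃) / (1 - μ * θ₂) / (1 - μ * θ₁)
      = -((q * (1 + Real.exp (-(μ * r))) + 1) / resolventDenom θ₁ θ₂ θ₃ μ) := by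
    rw [resolventDenom, div_div, div_div, neg_div, mul_assoc]
  have e3 := (div_le_iff₀ hpos).2 hdenμ
  rw [e1, e2]
  nlinarith [Real.exp_pos (μ * ξ)]

theorem exists_profileMap_fixed {θ₁ θ₂ θ₃ r η μ : ℝ} (hr : 0 ≤ r)
    (hη : 0 < η) (hημ : η < μ) (hμ : μ ≤ 2 * η)
    (h₁ : 0 < 1 - η * θ₁) (h₂ : 0 < 1 - η * θ₂) (h₃ : 0 < 1 - η * θ₃)
    (k₁ : 0 < 1 - μ * θ₁) (k₂ : 0 < 1 - μ * θ₂) (k₃ : 0 < 1 - μ * θ₃)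
    (hden : resolventDenom θ₁ θ₂ θ₃ η = 1 + Real.exp (-(η * r)))
    (hdenμ : 1 + Real.exp (-(μ * r)) < resolventDenom θ₁ θ₂ θ₃ μ) :
    ∃ φ, UnitMono φ ∧ profileMap θ₁ θ₂ θ₃ r φ = φ ∧ (∀ x, φ x ≤ Real.exp (η * x)) ∧
      ∃ x, 0 < φ x := by
  obtain ⟨q, hq1, hq⟩ : ∃ q : ℝ, 1 ≤ q ∧
      q * (1 + Real.exp (-(μ * r))) + 1 ≤ q * resolventDenom θ₁ θ₂ θ₃ μ := by
    set d := resolventDenom θ₁ θ₂ θ₃ μ - (1 + Real.exp (-(μ * r)))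
    have hd : 0 < d := sub_pos.2 hdenμ
    refine ⟨max 1 (1 / d), le_max_left _ _, ?_⟩
    have : 1 ≤ max 1 (1 / d) * d := (div_le_iff₀ hd).1 (le_max_right _ _)
    linarith [mul_sub (max 1 (1 / d)) (resolventDenom θ₁ θ₂ θ₃ μ) (1 + Real.exp (-(μ * r)))]
  have hemono : Monotone fun x => Real.exp (η * x) := fun x y h =>
    Real.exp_le_exp.2 (mul_le_mul_of_nonneg_left h hη.le)
  set u₀ : ℝ → ℝ := fun x => min (Real.exp (η * x)) 1 with hu₀
  have hu₀m : UnitMono u₀ := ⟨hemono.min monotone_const, fun x =>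
    ⟨le_min (Real.exp_pos _).le zero_le_one, min_le_right _ _⟩⟩
  let u : ℕ → ℝ → ℝ := fun n => (profileMap θ₁ θ₂ θ₃ r)^[n] u₀
  have hsucc : ∀ n, u (n + 1) = profileMap θ₁ θ₂ θ₃ r (u n) := fun n =>
    Function.iterate_succ_apply' _ _ _
  have hum : ∀ n, UnitMono (u n) := fun n => by
    induction n with
    | zero => exact hu₀m
    | succ n ih => rw [hsucc]; exact ih.profileMap _ _ _ _
  have hup : ∀ n x, u n x ≤ Real.exp (η * x) := fun n => by
    induction n with
    | zero => exact fun x => min_le_left _ _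
    | succ n ih => rw [hsucc]; exact profileMap_le_exp (hum n) h₁ h₂ h₃ hden ih
  have hlow : ∀ n x, Real.exp (η * x) - q * Real.exp (μ * x) ≤ u n x := fun n => by
    induction n with
    | zero =>
      intro x
      have hqx : 0 ≤ q * Real.exp (μ * x) := by positivity
      refine le_min (by linarith) ?_
      rcases le_or_gt 0 x with h | h
      · have h1 : Real.exp (η * x) ≤ Real.exp (μ * x) :=
          Real.exp_le_exp.2 (mul_le_mul_of_nonneg_right hημ.le h)
        nlinarith [Real.exp_pos (μ * x)]
      · have : Real.exp (η * x) ≤ 1 := Real.exp_le_one_iff.2 (by nlinarith)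
        linarith
    | succ n ih =>
      rw [hsucc]
      exact le_profileMap_exp (hum n) hr hη hημ hμ hq1 h₁ h₂ h₃ k₁ k₂ k₃ hden hq ih
  have hanti : ∀ n x, u (n + 1) x ≤ u n x := fun n => by
    induction n with
    | zero =>
      exact fun x => le_min (hup 1 x) ((hum 1).2 x).2
    | succ n ih =>
      intro x
      rw [hsucc (n + 1), hsucc n]
      have := profileMap_mono (hum (n + 1)) (hum n) θ₁ θ₂ θ₃ r ih x
      rwa [hsucc n] at this
  have hlim : ∀ x, ∃ y, Tendsto (fun n => u n x) atTop (𝓝 y) := fun x =>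
    ⟨_, tendsto_atTop_ciInf (antitone_nat_of_succ_le fun n => hanti n x)
      ⟨0, by rintro _ ⟨n, rfl⟩; exact ((hum n).2 x).1⟩⟩
  choose φ hφ using hlim
  refine ⟨φ, UnitMono.of_tendsto hum hφ, funext fun x => ?_,
    fun x => le_of_tendsto' (hφ x) fun n => hup n x, ?_⟩
  · have h1 := tendsto_profileMap hum hφ θ₁ θ₂ θ₃ r x
    have h2 := (hφ x).comp (tendsto_add_atTop_nat 1)
    refine tendsto_nhds_unique h1 (h2.congr fun n => ?_)
    rw [Function.comp_apply, hsucc]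
  -- Chosen so that `q e^{(μ - η)x} = 1/2`: there the lower barrier equals `e^{ηx} / 2 > 0`.
  · set x := -Real.log (2 * q) / (μ - η) with hx
    have hq0 : 0 < 2 * q := by linarith
    refine ⟨x, lt_of_lt_of_le ?_ (ge_of_tendsto' (hφ x) fun n => hlow n x)⟩
    have e : Real.exp (μ * x) = Real.exp (η * x) * (2 * q)⁻¹ := by
      have : μ * x = η * x + -Real.log (2 * q) := by
        rw [hx]; field_simp [sub_ne_zero.2 hημ.ne']; ring
      rw [this, Real.exp_add, Real.exp_neg, Real.exp_log hq0]
    have e' : q * (Real.exp (η * x) * (2 * q)⁻¹) = Real.exp (η * x) / 2 := by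
      field_simp
    rw [e, e']
    linarith [Real.exp_pos (η * x)]

/-! ### From fixed points to profiles. -/

theorem mem_Gam_of_fixed {θ₁ θ₂ θ₃ r η : ℝ} (hη : 0 < η) (hθ₁ : θ₁ ≠ 0) {φ : ℝ → ℝ}
    (hφ : UnitMono φ) (hfix : profileMap θ₁ θ₂ θ₃ r φ = φ)
    (hle : ∀ x, φ x ≤ Real.exp (η * x)) {x₀ : ℝ} (hx₀ : 0 < φ x₀) : φ ∈ Gam := by
  refine ⟨?_, hφ.1, ?_, ?_⟩
  · rw [← hfix]
    exact continuous_expAvg (((hφ.delayTerm r).expAvg θ₃).expAvg θ₂) hθ₁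
  · refine tendsto_of_tendsto_of_tendsto_of_le_of_le tendsto_const_nhds
      (Real.tendsto_exp_atBot.comp (tendsto_id.const_mul_atBot hη)) (fun x => (hφ.2 x).1) hle
  · have hbdd : BddAbove (Set.range φ) := ⟨1, by rintro _ ⟨x, rfl⟩; exact (hφ.2 x).2⟩
    have hlim := tendsto_atTop_ciSup hφ.1 hbdd
    set l := ⨆ x, φ x
    have hl : 0 < l := hx₀.trans_le (le_ciSup hbdd x₀)
    -- The translates of `φ` converge to the constant `l`; since the map commutes with translations
    -- and pointwise limits, `l` is itself a fixed constant.
    have hshift : ∀ x, Tendsto (fun n : ℕ => φ (x + n)) atTop (𝓝 l) := fun x =>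
      hlim.comp (tendsto_atTop_add_const_left _ _ tendsto_natCast_atTop_atTop)
    have h1 := tendsto_profileMap (fun n : ℕ => hφ.shift n) hshift θ₁ θ₂ θ₃ r 0
    simp only [profileMap_shift, hfix, profileMap_const] at h1
    have h2 := tendsto_nhds_unique h1 (hshift 0)
    have h3 : l * (1 - l) = 0 := by linarith
    have h4 : l = 1 := by
      rcases mul_eq_zero.1 h3 with h | h <;> linarith
    rwa [h4] at hlim

/-- Peeling off the averages one at a time expresses `φ'`, `φ''`, `φ'''` through `φ` and the
intermediate averages; Vieta's relations for the `θᵢ` then recombine them into the equation. -/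
theorem isProfileSolution_of_fixed {c D θ₁ θ₂ θ₃ r : ℝ} (hθ₁ : θ₁ ≠ 0) (hθ₂ : θ₂ ≠ 0)
    (hθ₃ : θ₃ ≠ 0) (hprod : θ₁ * θ₂ * θ₃ = c) (hpair : θ₁ * θ₂ + θ₂ * θ₃ + θ₁ * θ₃ = -D)
    (hsum : θ₁ + θ₂ + θ₃ = -c) {φ : ℝ → ℝ}
    (hφ : UnitMono φ) (hfix : profileMap θ₁ θ₂ θ₃ r φ = φ) : IsProfileSolution c D r φ := by
  set g₀ := delayTerm r φ with hg₀
  set g₁ := expAvg θ₃ g₀ with hg₁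
  set g₂ := expAvg θ₂ g₁ with hg₂
  have m₀ : UnitMono g₀ := hφ.delayTerm r
  have m₁ : UnitMono g₁ := m₀.expAvg θ₃
  have m₂ : UnitMono g₂ := m₁.expAvg θ₂
  have hφ' : φ = expAvg θ₁ g₂ := hfix.symm
  have c₂ : Continuous g₂ := continuous_expAvg m₁ hθ₂
  have c₁ : Continuous g₁ := continuous_expAvg m₀ hθ₃
  have cφ : Continuous φ := by rw [hφ']; exact continuous_expAvg m₂ hθ₁
  have c₀ : Continuous g₀ := by
    rw [hg₀]; unfold delayTerm; fun_prop
  have d₁ : ∀ x, HasDerivAt g₁ ((g₁ x - g₀ x) / θ₃) x := hasDerivAt_expAvg m₀ c₀ hθ₃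
  have d₂ : ∀ x, HasDerivAt g₂ ((g₂ x - g₁ x) / θ₂) x := hasDerivAt_expAvg m₁ c₁ hθ₂
  have d₃ : ∀ x, HasDerivAt φ ((φ x - g₂ x) / θ₁) x := fun x => by
    have := hasDerivAt_expAvg m₂ c₂ hθ₁ x
    rwa [← hφ'] at this
  have e1 : deriv φ = fun x => (φ x - g₂ x) / θ₁ := funext fun x => (d₃ x).deriv
  have e2 : iteratedDeriv 2 φ
      = fun x => ((φ x - g₂ x) / θ₁ - (g₂ x - g₁ x) / θ₂) / θ₁ := by
    rw [iteratedDeriv_succ, iteratedDeriv_one, e1]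
    exact funext fun x => (((d₃ x).sub (d₂ x)).div_const θ₁).deriv
  have e3 : iteratedDeriv 3 φ
      = fun x => (((φ x - g₂ x) / θ₁ - (g₂ x - g₁ x) / θ₂) / θ₁
        - ((g₂ x - g₁ x) / θ₂ - (g₁ x - g₀ x) / θ₃) / θ₂) / θ₁ := by
    rw [iteratedDeriv_succ, e2]
    exact funext fun x => (((((d₃ x).sub (d₂ x)).div_const θ₁).sub
      (((d₂ x).sub (d₁ x)).div_const θ₂)).div_const θ₁).deriv
  constructor
  · rw [hφ']
    have s₁ := contDiff_expAvg m₀ hθ₃ 0 (contDiff_zero.2 c₀)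
    have s₂ := contDiff_expAvg m₁ hθ₂ _ s₁
    exact contDiff_expAvg m₂ hθ₁ _ s₂
  · intro x
    have hg : φ (x - r) * (1 - φ x) = g₀ x - φ x := by
      rw [hg₀]; unfold delayTerm; ring
    rw [profileOp, e1, e2, e3, hg, ← hprod, ← neg_eq_iff_eq_neg.2 hpair]
    -- The coefficient `c` has two roles: it is the product of the `θᵢ` in front of `φ'''` and minus
    -- their sum in front of `φ'`.
    have hs : θ₁ * θ₂ * θ₃ = -(θ₁ + θ₂ + θ₃) := by rw [hsum, hprod, neg_neg]
    have e4 : θ₁ * θ₂ * θ₃ * ((φ x - g₂ x) / θ₁) = -(θ₁ + θ₂ + θ₃) * ((φ x - g₂ x) / θ₁) := by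
      rw [hs]
    simp only
    rw [e4]
    field_simp
    ring

/-- The numbers `-1/θᵢ` must be the roots of `p(x) = cx³ - Dx² - cx + 1`. Since `p(0) = 1`, `p(l) =
-2Dl² < 0` and `p` is eventually positive, there are two positive roots `b < l < d`; the third is
`-1/(cbd)`. -/
theorem exists_resolvent_params {c D l : ℝ} (hc : 0 < c) (hD : 0 < D) (hl : 0 < l)
    (hroot : charFun c D 0 l = 0) :
    ∃ θ₁ θ₂ θ₃ : ℝ, 0 < θ₁ ∧ θ₂ < 0 ∧ θ₃ < 0 ∧ θ₁ * θ₂ * θ₃ = c ∧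
      θ₁ * θ₂ + θ₂ * θ₃ + θ₁ * θ₃ = -D ∧ θ₁ + θ₂ + θ₃ = -c := by
  set p : ℝ → ℝ := fun x => c * x ^ 3 - D * x ^ 2 - c * x + 1 with hp
  have hpc : Continuous p := by fun_prop
  have hp0 : p 0 = 1 := by simp [hp]
  have hpl : p l < 0 := by
    simp only [charFun, mul_zero, neg_zero, Real.exp_zero] at hroot
    have : 0 < D * l ^ 2 := by positivity
    simp only [hp]; linarith
  obtain ⟨M, hM, hpM⟩ : ∃ M, l < M ∧ 0 < p M := by
    refine ⟨l + D / c + 1, by have := div_pos hD hc; linarith, ?_⟩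
    set k := D / c with hk
    have hk0 : 0 < k := div_pos hD hc
    have hDk : D = c * k := by rw [hk]; field_simp
    simp only [hp]
    rw [hDk]
    have : c * (l + k + 1) ^ 3 - c * k * (l + k + 1) ^ 2 - c * (l + k + 1) + 1
      = c * (l + k + 1) * ((l + k + 1) * (l + 1) - 1) + 1 := by ring
    rw [this]
    have : 0 ≤ (l + k + 1) * (l + 1) - 1 := by nlinarith [mul_pos hl hk0]
    positivity
  obtain ⟨b, ⟨hb0, hbl⟩, hb⟩ := intermediate_value_Ioo' hl.le hpc.continuousOn
    (show (0 : ℝ) ∈ Set.Ioo (p l) (p 0) from ⟨hpl, by rw [hp0]; exact one_pos⟩)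
  obtain ⟨d, ⟨hdl, hdM⟩, hd⟩ := intermediate_value_Ioo hM.le hpc.continuousOn
    (show (0 : ℝ) ∈ Set.Ioo (p l) (p M) from ⟨hpl, hpM⟩)
  have hd0 : 0 < d := hl.trans hdl
  have hbd : d - b ≠ 0 := (sub_pos.2 (hbl.trans hdl)).ne'
  simp only [hp] at hb hd
  -- The divided difference of `p` at `b` and `d`.
  have hq : c * (b ^ 2 + b * d + d ^ 2) - D * (b + d) - c = 0 := by
    apply mul_left_cancel₀ hbd
    linear_combination hd - hb
  have hprod : c * b * d * (b + d) - D * b * d = 1 := by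
    linear_combination b * hq - hb
  refine ⟨c * b * d, -1 / b, -1 / d, by positivity, div_neg_of_neg_of_pos (by norm_num) hb0,
    div_neg_of_neg_of_pos (by norm_num) hd0, by field_simp, ?_, ?_⟩
  · field_simp
    linear_combination -hprod
  · field_simp
    linear_combination (b + d) * hprod - b * d * hq

theorem exists_profile {c D l r η μ : ℝ} (hc : 0 < c) (hD : 0 < D) (hl : 0 < l)
    (hroot : charFun c D 0 l = 0) (hr : 0 ≤ r) (hη : 0 < η) (hημ : η < μ) (hμ : μ ≤ 2 * η)
    (hΔη : charFun c D r η = 0) (hΔμ : charFun c D r μ < 0) :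
    ∃ φ ∈ Gam, IsProfileSolution c D r φ := by
  obtain ⟨θ₁, θ₂, θ₃, hθ₁, hθ₂, hθ₃, hprod, hpair, hsum⟩ := exists_resolvent_params hc hD hl hroot
  have hden : ∀ x, resolventDenom θ₁ θ₂ θ₃ x = 1 + Real.exp (-(x * r)) - charFun c D r x :=
    fun x => by
      unfold resolventDenom charFun
      linear_combination (-x) * hsum + x ^ 2 * hpair - x ^ 3 * hprod
  have hneg : ∀ {x θ : ℝ}, 0 < x → θ < 0 → 0 < 1 - x * θ := fun hx hθ => by
    linarith [mul_neg_of_pos_of_neg hx hθ]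
  have hpos : ∀ x, 0 < x → charFun c D r x ≤ 0 → 0 < 1 - x * θ₁ := fun x hx hΔ => by
    have h := hden x
    -- As `Δ_r(x) ≤ 0`, the full product is positive, and so are the factors with `θ₂, θ₃ < 0`; the
    -- remaining factor is then positive.
    have h0 : 0 < resolventDenom θ₁ θ₂ θ₃ x := by rw [h]; linarith [Real.exp_pos (-(x * r))]
    exact pos_of_mul_pos_right h0 (mul_pos (hneg hx hθ₃) (hneg hx hθ₂)).le
  have hμ0 := hη.trans hημ
  obtain ⟨φ, hφ, hfix, hle, x₀, hx₀⟩ := exists_profileMap_fixed hr hη hημ hμ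
    (hpos η hη hΔη.le) (hneg hη hθ₂) (hneg hη hθ₃) (hpos μ hμ0 hΔμ.le) (hneg hμ0 hθ₂)
    (hneg hμ0 hθ₃) (by rw [hden, hΔη, sub_zero]) (by rw [hden]; linarith)
  exact ⟨φ, mem_Gam_of_fixed hη hθ₁.ne' hφ hfix hle hx₀,
    isProfileSolution_of_fixed hθ₁.ne' hθ₂.ne hθ₃.ne hprod hpair hsum hφ hfix⟩

/-! ### From the profile equation to the evolution equation. -/

theorem IsProfileSolution.isPDESolution {c D τ : ℝ} {φ : ℝ → ℝ}
    (h : IsProfileSolution c D (c * τ) φ) : IsPDESolution D τ fun x t => φ (x + c * t) := by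
  obtain ⟨hφ, hP⟩ := h
  have hd1 : Differentiable ℝ φ := hφ.differentiable (by norm_num)
  have hd3 : Differentiable ℝ (iteratedDeriv 2 φ) :=
    hφ.differentiable_iteratedDeriv 2 (by norm_num)
  have hlin : ∀ x t : ℝ, HasDerivAt (fun s => x + c * s) c t := fun x t => by
    simpa using ((hasDerivAt_id t).const_mul c).const_add x
  have hcomp : ∀ f : ℝ → ℝ, Differentiable ℝ f → ∀ x t : ℝ,
      deriv (fun s => f (x + c * s)) t = deriv f (x + c * t) * c := fun f hf x t =>
    ((hf _).hasDerivAt.comp t (hlin x t)).deriv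
  refine ⟨hφ.comp (by fun_prop : ContDiff ℝ 3 fun p : ℝ × ℝ => p.1 + c * p.2), fun x t => ?_⟩
  have h2 : ∀ s, iteratedDeriv 2 (fun y => φ (y + c * s))
      = fun y => iteratedDeriv 2 φ (y + c * s) := fun s => iteratedDeriv_comp_add_const _ _ _
  simp only [h2]
  rw [hcomp φ hd1, hcomp _ hd3, ← iteratedDeriv_succ]
  have := hP (x + c * t)
  have e : x + c * (t - τ) = x + c * t - c * τ := by ring
  rw [e]
  unfold profileOp at this
  linarith

/-! ### Gluing sums of exponentials. -/

/-- `k + A e^{α x} + B e^{β x}`. -/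
noncomputable def expTwo (k A α B β x : ℝ) : ℝ :=
  k + A * Real.exp (α * x) + B * Real.exp (β * x)

theorem hasDerivAt_expTwo (k A α B β x : ℝ) :
    HasDerivAt (expTwo k A α B β) (expTwo 0 (A * α) α (B * β) β x) x := by
  have h : ∀ l : ℝ, HasDerivAt (fun x => Real.exp (l * x)) (Real.exp (l * x) * l) x := fun l => by
    simpa using ((hasDerivAt_id x).const_mul l).exp
  refine ((((h α).const_mul A).const_add k).add ((h β).const_mul B)).congr_deriv ?_
  unfold expTwo; ring

theorem deriv_expTwo (k A α B β : ℝ) :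
    deriv (expTwo k A α B β) = expTwo 0 (A * α) α (B * β) β :=
  funext fun x => (hasDerivAt_expTwo k A α B β x).deriv

theorem contDiff_expTwo (k A α B β : ℝ) (n : ℕ) : ContDiff ℝ n (expTwo k A α B β) := by
  unfold expTwo; fun_prop

theorem iteratedDeriv_two_expTwo (k A α B β : ℝ) :
    iteratedDeriv 2 (expTwo k A α B β) = expTwo 0 (A * α * α) α (B * β * β) β := by
  rw [iteratedDeriv_succ, iteratedDeriv_one, deriv_expTwo, deriv_expTwo]

theorem iteratedDeriv_three_expTwo (k A α B β : ℝ) :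
    iteratedDeriv 3 (expTwo k A α B β) = expTwo 0 (A * α * α * α) α (B * β * β * β) β := by
  rw [iteratedDeriv_succ, iteratedDeriv_two_expTwo, deriv_expTwo]

theorem abs_expTwo_le (k A B : ℝ) {α β x K : ℝ} (h : α * x ≤ K) (h' : β * x ≤ K) :
    |expTwo k A α B β x| ≤ |k| + (|A| + |B|) * Real.exp K := by
  have h1 : |A * Real.exp (α * x)| ≤ |A| * Real.exp K := by
    rw [abs_mul, abs_of_pos (Real.exp_pos _)]; gcongr
  have h2 : |B * Real.exp (β * x)| ≤ |B| * Real.exp K := by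
    rw [abs_mul, abs_of_pos (Real.exp_pos _)]; gcongr
  unfold expTwo
  linarith [abs_add_le (k + A * Real.exp (α * x)) (B * Real.exp (β * x)),
    abs_add_le k (A * Real.exp (α * x))]

/-- The function equal to `g` to the left of `x₀` and to `h` from `x₀` on. -/
noncomputable def glue (x₀ : ℝ) (g h : ℝ → ℝ) (x : ℝ) : ℝ := if x < x₀ then g x else h x

theorem glue_eventuallyEq_left {x₀ x : ℝ} (g h : ℝ → ℝ) (hx : x < x₀) :
    glue x₀ g h =ᶠ[𝓝 x] g := by
  filter_upwards [Iio_mem_nhds hx] with y hy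
  exact if_pos hy

theorem glue_eventuallyEq_right {x₀ x : ℝ} (g h : ℝ → ℝ) (hx : x₀ < x) :
    glue x₀ g h =ᶠ[𝓝 x] h := by
  filter_upwards [Ioi_mem_nhds hx] with y hy
  exact if_neg (not_lt.2 (le_of_lt hy))

theorem continuous_glue {x₀ : ℝ} {g h : ℝ → ℝ} (hg : Continuous g) (hh : Continuous h)
    (h0 : g x₀ = h x₀) : Continuous (glue x₀ g h) := by
  have e : glue x₀ g h = fun x => if x₀ ≤ x then h x else g x := by
    funext x
    unfold glue
    split_ifs with h1 h2 h2
    · exact absurd h1 (not_lt.2 h2)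
    · rfl
    · rfl
    · exact absurd (not_le.1 h2) h1
  rw [e]
  exact hh.if_le hg continuous_const continuous_id fun x hx => by rw [← hx, h0]

theorem hasDerivAt_glue {x₀ : ℝ} {g h : ℝ → ℝ} (hg : Differentiable ℝ g)
    (hh : Differentiable ℝ h) (h0 : g x₀ = h x₀) (h1 : deriv g x₀ = deriv h x₀) (x : ℝ) :
    HasDerivAt (glue x₀ g h) (glue x₀ (deriv g) (deriv h) x) x := by
  rcases lt_trichotomy x x₀ with hx | rfl | hx
  · rw [show glue x₀ (deriv g) (deriv h) x = deriv g x from if_pos hx]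
    exact (hg x).hasDerivAt.congr_of_eventuallyEq (glue_eventuallyEq_left g h hx)
  · rw [show glue x (deriv g) (deriv h) x = deriv h x from if_neg (lt_irrefl x)]
    have hl : HasDerivWithinAt (glue x g h) (deriv h x) (Set.Iic x) x := by
      rw [← h1]
      refine (hg x).hasDerivAt.hasDerivWithinAt.congr_of_mem (fun y hy => ?_) Set.self_mem_Iic
      unfold glue
      split_ifs with hyx
      · rfl
      · rw [le_antisymm hy (not_lt.1 hyx), h0]
    have hr : HasDerivWithinAt (glue x g h) (deriv h x) (Set.Ici x) x :=
      (hh x).hasDerivAt.hasDerivWithinAt.congr_of_mem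
        (fun y hy => if_neg (not_lt.2 hy)) Set.self_mem_Ici
    have := hl.union hr
    rwa [Set.Iic_union_Ici, hasDerivWithinAt_univ] at this
  · rw [show glue x₀ (deriv g) (deriv h) x = deriv h x from if_neg (not_lt.2 hx.le)]
    exact (hh x).hasDerivAt.congr_of_eventuallyEq (glue_eventuallyEq_right g h hx)

theorem exists_abs_glue_le {x₀ : ℝ} {g h : ℝ → ℝ} (hg : ∃ M, ∀ x, x ≤ x₀ → |g x| ≤ M)
    (hh : ∃ M, ∀ x, x₀ ≤ x → |h x| ≤ M) : ∃ M, ∀ x, |glue x₀ g h x| ≤ M := by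
  obtain ⟨M, hM⟩ := hg
  obtain ⟨M', hM'⟩ := hh
  refine ⟨max M M', fun x => ?_⟩
  unfold glue
  split_ifs with hx
  · exact (hM x hx.le).trans (le_max_left _ _)
  · exact (hM' x (not_lt.1 hx)).trans (le_max_right _ _)

theorem iteratedDeriv_glue {x₀ x : ℝ} (g h : ℝ → ℝ) (hx : x ≠ x₀) (n : ℕ) :
    iteratedDeriv n (glue x₀ g h) x = glue x₀ (iteratedDeriv n g) (iteratedDeriv n h) x := by
  rcases hx.lt_or_gt with hx | hx
  · rw [(glue_eventuallyEq_left g h hx).iteratedDeriv_eq]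
    exact (if_pos hx).symm
  · rw [(glue_eventuallyEq_right g h hx).iteratedDeriv_eq]
    exact (if_neg (not_lt.2 hx.le)).symm

theorem contDiffAt_glue {x₀ x : ℝ} {g h : ℝ → ℝ} {n : ℕ} (hg : ContDiff ℝ n g)
    (hh : ContDiff ℝ n h) (hx : x ≠ x₀) : ContDiffAt ℝ n (glue x₀ g h) x := by
  rcases hx.lt_or_gt with hx | hx
  · exact hg.contDiffAt.congr_of_eventuallyEq (glue_eventuallyEq_left g h hx)
  · exact hh.contDiffAt.congr_of_eventuallyEq (glue_eventuallyEq_right g h hx)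

theorem contDiffAt_iteratedDeriv_glue {x₀ x : ℝ} {g h : ℝ → ℝ} {n : ℕ}
    (hg : ContDiff ℝ (n + 1 : ℕ) g) (hh : ContDiff ℝ (n + 1 : ℕ) h) (hx : x ≠ x₀) :
    ContDiffAt ℝ 1 (iteratedDeriv n (glue x₀ g h)) x := by
  have key : ∀ f : ℝ → ℝ, ContDiff ℝ (n + 1 : ℕ) f → ContDiff ℝ 1 (iteratedDeriv n f) :=
    fun f hf => by
      rw [iteratedDeriv_eq_iterate]
      exact ContDiff.iterate_deriv' 1 n (by rwa [add_comm, Nat.cast_add, Nat.cast_one] at hf)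
  have h1 : ContDiffAt ℝ 1 (glue x₀ (iteratedDeriv n g) (iteratedDeriv n h)) x :=
    contDiffAt_glue (n := 1) (key g hg) (key h hh) hx
  refine h1.congr_of_eventuallyEq ?_
  filter_upwards [isOpen_ne.mem_nhds hx] with y hy
  exact iteratedDeriv_glue g h hy n

theorem isBC1_glue {x₀ : ℝ} {g h : ℝ → ℝ} (hg : ContDiff ℝ 1 g) (hh : ContDiff ℝ 1 h)
    (h0 : g x₀ = h x₀) (h1 : deriv g x₀ = deriv h x₀)
    (bg : ∃ M, ∀ x, x ≤ x₀ → |g x| ≤ M) (bh : ∃ M, ∀ x, x₀ ≤ x → |h x| ≤ M)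
    (bg' : ∃ M, ∀ x, x ≤ x₀ → |deriv g x| ≤ M) (bh' : ∃ M, ∀ x, x₀ ≤ x → |deriv h x| ≤ M) :
    IsBC1 (glue x₀ g h) := by
  have hd := hasDerivAt_glue (hg.differentiable one_ne_zero) (hh.differentiable one_ne_zero) h0 h1
  have hderiv : deriv (glue x₀ g h) = glue x₀ (deriv g) (deriv h) :=
    funext fun x => (hd x).deriv
  refine ⟨contDiff_one_iff_deriv.2 ⟨fun x => (hd x).differentiableAt, ?_⟩,
    exists_abs_glue_le bg bh, ?_⟩
  · rw [hderiv]
    exact continuous_glue (contDiff_one_iff_deriv.1 hg).2 (contDiff_one_iff_deriv.1 hh).2 h1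
  · rw [hderiv]
    exact exists_abs_glue_le bg' bh'

theorem piecewiseRegular_glue {x₀ : ℝ} {g h : ℝ → ℝ} (hg : ContDiff ℝ (4 : ℕ) g)
    (hh : ContDiff ℝ (4 : ℕ) h)
    (b2 : ∃ M, ∀ x, |glue x₀ (iteratedDeriv 2 g) (iteratedDeriv 2 h) x| ≤ M)
    (b3 : ∃ M, ∀ x, |glue x₀ (iteratedDeriv 3 g) (iteratedDeriv 3 h) x| ≤ M) :
    PiecewiseRegular {x₀} (glue x₀ g h) := by
  have hne : ∀ {x}, x ∉ ({x₀} : Finset ℝ) → x ≠ x₀ := fun hx => by simpa using hx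
  have c : ∀ n : ℕ, n ≤ 3 → ∀ x, x ∉ ({x₀} : Finset ℝ) →
      ContDiffAt ℝ 1 (iteratedDeriv n (glue x₀ g h)) x := fun n hn x hx =>
    contDiffAt_iteratedDeriv_glue (hg.of_le (by exact_mod_cast Nat.succ_le_succ hn))
      (hh.of_le (by exact_mod_cast Nat.succ_le_succ hn)) (hne hx)
  have ac : ∀ n : ℕ, n ≤ 3 → ∀ a b : ℝ, a ≤ b → (∀ ξ ∈ Set.Icc a b, ξ ∉ ({x₀} : Finset ℝ)) →
      AbsolutelyContinuousOnInterval (iteratedDeriv n (glue x₀ g h)) a b :=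
    fun n hn a b hab hT => ContDiffOn.absolutelyContinuousOnInterval fun x hx =>
      (c n hn x (hT x (by rwa [Set.uIcc_of_le hab] at hx))).contDiffWithinAt
  refine ⟨fun x hx => ?_, fun x hx => (c 2 (by norm_num) x hx).differentiableAt one_ne_zero,
    ac 2 (by norm_num), ac 3 le_rfl, ?_, ?_⟩
  · have := (c 1 (by norm_num) x hx).differentiableAt one_ne_zero
    rwa [iteratedDeriv_one] at this
  · obtain ⟨M, hM⟩ := b2
    exact ⟨M, fun x hx => by rw [iteratedDeriv_glue g h (hne hx)]; exact hM x⟩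
  · obtain ⟨M, hM⟩ := b3
    exact ⟨M, fun x hx => by rw [iteratedDeriv_glue g h (hne hx)]; exact hM x⟩

/-- The signs of the exponents make both pieces, and all their derivatives, bounded on their own
half-line; matching values and slopes gives `C¹` at the junction. -/
theorem glue_expTwo_regular {x₀ k A α B β k' A' α' B' β' : ℝ} (hα : 0 ≤ α) (hβ : 0 ≤ β)
    (hα' : α' ≤ 0) (hβ' : β' ≤ 0)
    (h0 : expTwo k A α B β x₀ = expTwo k' A' α' B' β' x₀)
    (h1 : expTwo 0 (A * α) α (B * β) β x₀ = expTwo 0 (A' * α') α' (B' * β') β' x₀) :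
    IsBC1 (glue x₀ (expTwo k A α B β) (expTwo k' A' α' B' β')) ∧
      PiecewiseRegular {x₀} (glue x₀ (expTwo k A α B β) (expTwo k' A' α' B' β')) := by
  have bl : ∀ k A B : ℝ, ∃ M, ∀ x, x ≤ x₀ → |expTwo k A α B β x| ≤ M := fun k A B =>
    ⟨_, fun x hx => abs_expTwo_le k A B (K := max (α * x₀) (β * x₀))
      ((mul_le_mul_of_nonneg_left hx hα).trans (le_max_left _ _))
      ((mul_le_mul_of_nonneg_left hx hβ).trans (le_max_right _ _))⟩
  have br : ∀ k A B : ℝ, ∃ M, ∀ x, x₀ ≤ x → |expTwo k A α' B β' x| ≤ M := fun k A B =>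
    ⟨_, fun x hx => abs_expTwo_le k A B (K := max (α' * x₀) (β' * x₀))
      ((mul_le_mul_of_nonpos_left hx hα').trans (le_max_left _ _))
      ((mul_le_mul_of_nonpos_left hx hβ').trans (le_max_right _ _))⟩
  constructor
  · refine isBC1_glue (contDiff_expTwo _ _ _ _ _ 1) (contDiff_expTwo _ _ _ _ _ 1) h0 ?_
      (bl _ _ _) (br _ _ _) ?_ ?_
    · rw [deriv_expTwo, deriv_expTwo, h1]
    · rw [deriv_expTwo]; exact bl _ _ _
    · rw [deriv_expTwo]; exact br _ _ _
  · refine piecewiseRegular_glue (contDiff_expTwo _ _ _ _ _ _) (contDiff_expTwo _ _ _ _ _ _)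
      (exists_abs_glue_le ?_ ?_) (exists_abs_glue_le ?_ ?_)
    · rw [iteratedDeriv_two_expTwo]; exact bl _ _ _
    · rw [iteratedDeriv_two_expTwo]; exact br _ _ _
    · rw [iteratedDeriv_three_expTwo]; exact bl _ _ _
    · rw [iteratedDeriv_three_expTwo]; exact br _ _ _

theorem profileOp_of_eventuallyEq {c D r k A α B β x : ℝ} {f : ℝ → ℝ}
    (h : f =ᶠ[𝓝 x] expTwo k A α B β) :
    profileOp c D r f x = A * (c * α ^ 3 + D * α ^ 2 - c * α) * Real.exp (α * x)
      + B * (c * β ^ 3 + D * β ^ 2 - c * β) * Real.exp (β * x) + f (x - r) * (1 - f x) := by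
  unfold profileOp
  rw [h.iteratedDeriv_eq, h.iteratedDeriv_eq, h.deriv_eq, deriv_expTwo,
    iteratedDeriv_two_expTwo, iteratedDeriv_three_expTwo]
  unfold expTwo
  ring

/-! ### The explicit quasi solutions. -/

theorem phiUpper_eq_glue (η : ℝ) :
    phiUpper η = glue 0 (expTwo 0 (1 / 2) η 0 0) (expTwo 1 (-1 / 2) (-η) 0 0) := by
  funext x
  unfold phiUpper glue expTwo
  split_ifs
  · ring
  · rw [neg_mul]; ring

theorem phiLower_eq_glue (η ε q x₁ : ℝ) :
    phiLower η ε q x₁ = glue x₁ (expTwo 0 (1 / 2) η (-(q / 2)) (η + ε))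
      (expTwo (plateau η ε q x₁) 0 0 0 0) := by
  funext x
  unfold phiLower glue expTwo
  split_ifs
  · rw [add_mul, Real.exp_add]; ring
  · ring

theorem phiUpper_regular {η : ℝ} (hη : 0 < η) :
    IsBC1 (phiUpper η) ∧ PiecewiseRegular {0} (phiUpper η) := by
  rw [phiUpper_eq_glue]
  refine glue_expTwo_regular hη.le le_rfl (by linarith) le_rfl ?_ ?_
  · unfold expTwo; norm_num
  · unfold expTwo; norm_num

theorem phiUpper_mem_Icc {η : ℝ} (hη : 0 < η) (x : ℝ) :
    0 ≤ phiUpper η x ∧ phiUpper η x ≤ 1 := by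
  unfold phiUpper
  split_ifs with h
  · have := Real.exp_pos (η * x)
    have : Real.exp (η * x) ≤ 1 := Real.exp_le_one_iff.2 (by nlinarith)
    constructor <;> linarith
  · have := Real.exp_pos (-(η * x))
    have : Real.exp (-(η * x)) ≤ 1 := Real.exp_le_one_iff.2 (by nlinarith)
    constructor <;> linarith

theorem phiUpper_monotone {η : ℝ} (hη : 0 < η) : Monotone (phiUpper η) := by
  intro x y hxy
  unfold phiUpper
  split_ifs with hx hy hy
  · have : Real.exp (η * x) ≤ Real.exp (η * y) := Real.exp_le_exp.2 (by nlinarith)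
    linarith
  · have h1 : Real.exp (η * x) ≤ 1 := Real.exp_le_one_iff.2 (by nlinarith)
    have h2 : Real.exp (-(η * y)) ≤ 1 := Real.exp_le_one_iff.2 (by nlinarith)
    linarith
  · exact absurd (hxy.trans_lt hy) hx
  · have : Real.exp (-(η * y)) ≤ Real.exp (-(η * x)) := Real.exp_le_exp.2 (by nlinarith)
    linarith

theorem phiUpper_mem_Gam {η : ℝ} (hη : 0 < η) : phiUpper η ∈ Gam := by
  refine ⟨(phiUpper_regular hη).1.1.continuous, phiUpper_monotone hη, ?_, ?_⟩
  · have h := (Real.tendsto_exp_atBot.comp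
      ((tendsto_id (α := ℝ)).const_mul_atBot hη)).const_mul (1 / 2)
    rw [mul_zero] at h
    refine h.congr' ?_
    filter_upwards [eventually_lt_atBot 0] with x hx
    exact (if_pos hx).symm
  · have h := ((Real.tendsto_exp_neg_atTop_nhds_zero.comp
      ((tendsto_id (α := ℝ)).const_mul_atTop hη)).const_mul (1 / 2)).const_sub 1
    rw [mul_zero, sub_zero] at h
    refine h.congr' ?_
    filter_upwards [eventually_ge_atTop 0] with x hx
    exact (if_neg (not_lt.2 hx)).symm

theorem isQuasiUpper_phiUpper {c D r η : ℝ} (hη : 0 < η) (hr : 0 ≤ r)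
    (hroot : charFun c D r η = 0) (hrη : r ≤ 2 * D * η) :
    IsQuasiUpper c D r (phiUpper η) := by
  obtain ⟨hBC, hreg⟩ := phiUpper_regular hη
  refine ⟨hBC, {0}, hreg, fun x hx => ?_⟩
  have hx0 : x ≠ 0 := by simpa using hx
  unfold charFun at hroot
  rcases hx0.lt_or_gt with hx | hx
  · have he : phiUpper η =ᶠ[𝓝 x] expTwo 0 (1 / 2) η 0 0 := by
      rw [phiUpper_eq_glue]; exact glue_eventuallyEq_left _ _ hx
    have h1 : phiUpper η (x - r) = 1 / 2 * (Real.exp (-(η * r)) * Real.exp (η * x)) := by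
      rw [← Real.exp_add, phiUpper, if_pos (by linarith)]; ring_nf
    have h2 : phiUpper η x = 1 / 2 * Real.exp (η * x) := if_pos hx
    rw [profileOp_of_eventuallyEq he, h1, h2]
    have e : c * η ^ 3 + D * η ^ 2 - c * η = -Real.exp (-(η * r)) := by linarith
    rw [e]
    have := mul_pos (Real.exp_pos (-(η * r))) (mul_pos (Real.exp_pos (η * x)) (Real.exp_pos (η * x)))
    linarith
  · have he : phiUpper η =ᶠ[𝓝 x] expTwo 1 (-1 / 2) (-η) 0 0 := by
      rw [phiUpper_eq_glue]; exact glue_eventuallyEq_right _ _ hx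
    have h2 : phiUpper η x = 1 - 1 / 2 * Real.exp (-(η * x)) := if_neg (not_lt.2 hx.le)
    rw [profileOp_of_eventuallyEq he, h2, neg_mul η x]
    -- Reflecting `η` flips the odd terms only, so the root equation leaves the surplus `2Dη²`. It
    -- absorbs `1 - e^{-ηr} ≤ ηr` because `r ≤ 2Dη`.
    have e : c * (-η) ^ 3 + D * (-η) ^ 2 - c * -η = Real.exp (-(η * r)) + 2 * D * η ^ 2 := by
      linear_combination -hroot
    rw [e]
    have h3 : phiUpper η (x - r) ≤ 1 := (phiUpper_mem_Icc hη _).2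
    have h4 := Real.add_one_le_exp (-(η * r))
    have h5 : η * r ≤ 2 * D * η ^ 2 := by nlinarith
    have h6 := mul_nonneg (by linarith : 0 ≤ Real.exp (-(η * r)) + 2 * D * η ^ 2
      - phiUpper η (x - r)) (Real.exp_pos (-(η * x))).le
    linarith

theorem exists_isQuasiLower_phiLower {c D r η ε : ℝ} (hη : 0 < η) (hε : 0 < ε) (hεη : ε ≤ η)
    (hr : 0 ≤ r) (hroot : charFun c D r η = 0) (hneg : charFun c D r (η + ε) < 0) :
    ∃ q₀ : ℝ, 0 < q₀ ∧ ∀ q : ℝ, q₀ ≤ q →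
      ∃ ξ₁ : ℝ, ξ₁ < 0 ∧ 0 < plateau η ε q ξ₁ ∧ plateau η ε q ξ₁ < 1 ∧
        IsQuasiLower c D r (phiLower η ε q ξ₁) ∧
        ∀ ξ : ℝ, 0 ≤ phiLower η ε q ξ₁ ξ ∧ phiLower η ε q ξ₁ ξ ≤ phiUpper η ξ := by
  -- The gain is `-(q/2) Δ_r(η + ε) e^{(η+ε)x}` and the quadratic loss at most `(1/4) e^{(η+ε)x}`;
  -- the bound `q ≥ 1` forces `ξ₁ < 0`.
  refine ⟨max 1 (1 / (2 * -charFun c D r (η + ε))), by positivity, fun q hq => ?_⟩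
  have hq1 : 1 ≤ q := (le_max_left _ _).trans hq
  have hq2 : 1 ≤ q * (2 * -charFun c D r (η + ε)) :=
    (div_le_iff₀ (by linarith)).1 ((le_max_right _ _).trans hq)
  have hηε : 0 < η + ε := by linarith
  have hq0 : 0 < q := by linarith
  -- The critical point of `(1 - q e^{εξ}) e^{ηξ}`, so that the plateau joins with zero slope.
  set x₁ := Real.log (η / (q * (η + ε))) / ε with hx₁
  have hfrac : 0 < η / (q * (η + ε)) := by positivity
  have hex : Real.exp (ε * x₁) = η / (q * (η + ε)) := by
    rw [hx₁, mul_div_cancel₀ _ hε.ne', Real.exp_log hfrac]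
  have hqex : q * Real.exp (ε * x₁) = η / (η + ε) := by rw [hex]; field_simp
  have hfrac1 : η / (η + ε) < 1 := (div_lt_one hηε).2 (by linarith)
  have hx₁0 : x₁ < 0 := by
    refine div_neg_of_neg_of_pos (Real.log_neg hfrac ?_) hε
    rw [div_lt_one (by positivity)]
    nlinarith
  have hfac : ∀ x, x ≤ x₁ → 0 < 1 - q * Real.exp (ε * x) := fun x hx => by
    have : Real.exp (ε * x) ≤ Real.exp (ε * x₁) :=
      Real.exp_le_exp.2 (mul_le_mul_of_nonneg_left hx hε.le)
    nlinarith
  have hfac1 : ∀ x, 1 / 2 * (1 - q * Real.exp (ε * x)) * Real.exp (η * x)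
      ≤ 1 / 2 * Real.exp (η * x) := fun x => by
    have : 0 < q * Real.exp (ε * x) * Real.exp (η * x) := by positivity
    linarith
  have hpl0 : 0 < plateau η ε q x₁ :=
    mul_pos (mul_pos one_half_pos (hfac x₁ le_rfl)) (Real.exp_pos _)
  have hple : plateau η ε q x₁ ≤ 1 / 2 * Real.exp (η * x₁) := hfac1 x₁
  have hex1 : Real.exp (η * x₁) ≤ 1 := Real.exp_le_one_iff.2 (by nlinarith)
  have hpl1 : plateau η ε q x₁ < 1 := by linarith
  have hnn : ∀ x, 0 ≤ phiLower η ε q x₁ x := fun x => by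
    unfold phiLower
    split_ifs with hx
    · have := hfac x hx.le
      positivity
    · exact hpl0.le
  refine ⟨x₁, hx₁0, hpl0, hpl1, ?_, fun x => ⟨hnn x, ?_⟩⟩
  · have hreg : IsBC1 (phiLower η ε q x₁) ∧ PiecewiseRegular {x₁} (phiLower η ε q x₁) := by
      rw [phiLower_eq_glue]
      refine glue_expTwo_regular hη.le hηε.le le_rfl le_rfl ?_ ?_
      · unfold expTwo plateau
        rw [add_mul, Real.exp_add]; ring
      · unfold expTwo
        rw [add_mul, Real.exp_add, hex]
        field_simp
        ring
    refine ⟨hreg.1, {x₁}, hreg.2, fun x hx => ?_⟩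
    have hxne : x ≠ x₁ := by simpa using hx
    rcases hxne.lt_or_gt with hx | hx
    · have he : phiLower η ε q x₁ =ᶠ[𝓝 x] expTwo 0 (1 / 2) η (-(q / 2)) (η + ε) := by
        rw [phiLower_eq_glue]; exact glue_eventuallyEq_left _ _ hx
      have hv : ∀ y, y < x₁ →
          phiLower η ε q x₁ y = 1 / 2 * (1 - q * Real.exp (ε * y)) * Real.exp (η * y) :=
        fun y hy => if_pos hy
      have hx0 : x < 0 := hx.trans hx₁0
      have hxr : x - r < x₁ := by linarith
      have hprod : phiLower η ε q x₁ (x - r) * phiLower η ε q x₁ x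
          ≤ 1 / 4 * Real.exp ((η + ε) * x) := by
        have h1 : phiLower η ε q x₁ (x - r) ≤ 1 / 2 * Real.exp (η * x) := by
          rw [hv _ hxr]
          refine (hfac1 _).trans ?_
          have : Real.exp (η * (x - r)) ≤ Real.exp (η * x) := Real.exp_le_exp.2 (by nlinarith)
          linarith
        have h2 : phiLower η ε q x₁ x ≤ 1 / 2 * Real.exp (η * x) := by
          rw [hv _ hx]; exact hfac1 x
        have h3 := mul_le_mul h1 h2 (hnn x) (by positivity)
        have h4 : Real.exp (η * x) * Real.exp (η * x) ≤ Real.exp ((η + ε) * x) := by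
          rw [← Real.exp_add]; exact Real.exp_le_exp.2 (by nlinarith)
        linarith
      have hshift : phiLower η ε q x₁ (x - r)
          = 1 / 2 * (Real.exp (-(η * r)) * Real.exp (η * x))
            - q / 2 * (Real.exp (-((η + ε) * r)) * Real.exp ((η + ε) * x)) := by
        rw [hv _ hxr, ← Real.exp_add, ← Real.exp_add,
          show -(η * r) + η * x = η * (x - r) by ring,
          show -((η + ε) * r) + (η + ε) * x = ε * (x - r) + η * (x - r) by ring, Real.exp_add]
        ring
      rw [profileOp_of_eventuallyEq he, mul_one_sub]
      have key : 0 ≤ (q * (2 * -charFun c D r (η + ε)) - 1) * Real.exp ((η + ε) * x) :=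
        mul_nonneg (by linarith) (Real.exp_pos _).le
      have hroot' : charFun c D r η * Real.exp (η * x) = 0 := by rw [hroot, zero_mul]
      unfold charFun at key hroot'
      linarith
    · have he : phiLower η ε q x₁ =ᶠ[𝓝 x] expTwo (plateau η ε q x₁) 0 0 0 0 := by
        rw [phiLower_eq_glue]; exact glue_eventuallyEq_right _ _ hx
      rw [profileOp_of_eventuallyEq he,
        show phiLower η ε q x₁ x = plateau η ε q x₁ from if_neg (not_lt.2 hx.le)]
      have := mul_nonneg (hnn (x - r)) (by linarith : 0 ≤ 1 - plateau η ε q x₁)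
      linarith
  · unfold phiLower
    split_ifs with hx
    · rw [phiUpper, if_pos (hx.trans hx₁0)]
      exact hfac1 x
    · have h1 := phiUpper_monotone hη (not_lt.1 hx)
      rw [phiUpper, if_pos hx₁0] at h1
      exact hple.trans h1

/-! ### Roots of the characteristic function. -/

theorem strictConvexOn_charFun {c D : ℝ} (hc : 0 < c) (hD : 0 < D) (r : ℝ) :
    StrictConvexOn ℝ (Set.Ici 0) (charFun c D r) := by
  have h1 : ∀ x, HasDerivAt (charFun c D r)
      (c * (3 * x ^ 2) + D * (2 * x) - c - r * Real.exp (-(x * r))) x := fun x => by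
    have he : HasDerivAt (fun x : ℝ => Real.exp (-(x * r))) (Real.exp (-(x * r)) * -r) x := by
      simpa using ((hasDerivAt_id x).mul_const r).neg.exp
    refine (((((hasDerivAt_pow 3 x).const_mul c).add ((hasDerivAt_pow 2 x).const_mul D)).sub
      ((hasDerivAt_id x).const_mul c)).add he).congr_deriv ?_
    norm_num
    ring
  have hcont : Continuous (charFun c D r) := by unfold charFun; fun_prop
  refine StrictMonoOn.strictConvexOn_of_deriv (convex_Ici 0) hcont.continuousOn ?_
  rw [interior_Ici, funext fun x => (h1 x).deriv]
  intro x hx y hy hxy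
  have hx0 : 0 < x := hx
  have h2 : c * (3 * x ^ 2) < c * (3 * y ^ 2) := by gcongr
  have h3 : D * (2 * x) < D * (2 * y) := by gcongr
  have h4 : r * Real.exp (-(y * r)) ≤ r * Real.exp (-(x * r)) := by
    rcases le_total 0 r with hr | hr
    · exact mul_le_mul_of_nonneg_left (Real.exp_le_exp.2 (by nlinarith)) hr
    · exact mul_le_mul_of_nonpos_left (Real.exp_le_exp.2 (by nlinarith)) hr
  simp only
  linarith

theorem charFun_neg_of_between {c D r x y z : ℝ} (hc : 0 < c) (hD : 0 < D) (hx : 0 ≤ x)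
    (hxy : x < y) (hyz : y < z) (hfx : charFun c D r x ≤ 0) (hfz : charFun c D r z ≤ 0) :
    charFun c D r y < 0 := by
  have h := (strictConvexOn_charFun hc hD r).lt_on_openSegment hx (hx.trans (hxy.trans hyz).le)
    (hxy.trans hyz).ne (by rw [openSegment_eq_Ioo (hxy.trans hyz)]; exact ⟨hxy, hyz⟩)
  exact h.trans_le (max_le hfx hfz)

/-- For `r ≥ 0`, `Δ_r ≤ Δ_0` is nonpositive at `l₁` and `l₂`, which places `η₁` in `(ε, l₁]` and
`η₂` in `[l₂, l₂ + 1)`. A third root would contradict strict convexity. -/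
theorem exists_charFun_roots {c D l₁ l₂ ε r : ℝ} (hc : 0 < c) (hD : 0 < D)
    (hroot₁ : charFun c D 0 l₁ = 0) (hroot₂ : charFun c D 0 l₂ = 0) (hε : 0 < ε)
    (hεl₁ : ε < l₁) (hεl₂ : l₁ + ε < l₂) (hr : 0 ≤ r) (hpos : 0 < charFun c D r ε) :
    ∃ η₁ η₂ : ℝ, ε < η₁ ∧ η₁ + ε < η₂ ∧ {η : ℝ | 0 < η ∧ charFun c D r η = 0} = {η₁, η₂} ∧
      charFun c D r (η₁ + ε) < 0 := by
  have hcont : Continuous (charFun c D r) := by unfold charFun; fun_prop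
  have hle : ∀ x, 0 ≤ x → charFun c D r x ≤ charFun c D 0 x := fun x hx => by
    have : Real.exp (-(x * r)) ≤ Real.exp (-(x * 0)) := Real.exp_le_exp.2 (by nlinarith)
    unfold charFun; linarith
  have h₁ : charFun c D r l₁ ≤ 0 := (hle l₁ (hε.trans hεl₁).le).trans_eq hroot₁
  have h₂ : charFun c D r l₂ ≤ 0 := (hle l₂ (by linarith)).trans_eq hroot₂
  have h₃ : 0 < charFun c D r (l₂ + 1) := by
    have hl0 : 0 < l₂ := by linarith
    have : 0 < c * (l₂ + 1) * (l₂ * (l₂ + 2)) + D * (l₂ + 1) ^ 2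
      + Real.exp (-((l₂ + 1) * r)) := by positivity
    unfold charFun
    linarith
  obtain ⟨η₁, ⟨hη₁, hη₁'⟩, e₁⟩ := intermediate_value_Ioc' hεl₁.le hcont.continuousOn
    (show (0 : ℝ) ∈ Set.Ico _ _ from ⟨h₁, hpos⟩)
  obtain ⟨η₂, ⟨hη₂, hη₂'⟩, e₂⟩ := intermediate_value_Ico (by linarith : l₂ ≤ l₂ + 1)
    hcont.continuousOn (show (0 : ℝ) ∈ Set.Ico _ _ from ⟨h₂, h₃⟩)
  have hη₁0 : 0 < η₁ := hε.trans hη₁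
  have hgap : η₁ + ε < η₂ := by linarith
  have hlt : η₁ < η₂ := by linarith
  refine ⟨η₁, η₂, hη₁, hgap, ?_, charFun_neg_of_between hc hD hη₁0.le (by linarith) hgap
    e₁.le e₂.le⟩
  ext η
  simp only [Set.mem_ofPred_eq, Set.mem_insert_iff, Set.mem_singleton_iff]
  constructor
  · rintro ⟨hη, e⟩
    by_contra hne
    rw [not_or] at hne
    rcases Ne.lt_or_gt hne.1 with h | h
    · exact (charFun_neg_of_between hc hD hη.le h hlt e.le e₂.le).ne e₁
    · rcases Ne.lt_or_gt hne.2 with h' | h'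
      · exact (charFun_neg_of_between hc hD hη₁0.le h h' e₁.le e₂.le).ne e
      · exact (charFun_neg_of_between hc hD hη₁0.le hlt h' e₁.le e.le).ne e₂
  · rintro (rfl | rfl)
    · exact ⟨hη₁0, e₁⟩
    · exact ⟨hη₁0.trans hlt, e₂⟩

theorem corollary4p1 (c D : ℝ) (hc : 0 < c) (hD : 0 < D)
    (l₁ l₂ : ℝ) (hl₁ : 0 < l₁) (hl : l₁ < l₂)
    (hroot₁ : charFun c D 0 l₁ = 0) (hroot₂ : charFun c D 0 l₂ = 0)
    (ε : ℝ) (hε : 0 < ε) (hεl₁ : ε < l₁) (hεl₂ : l₁ + ε < l₂) :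
    ∃ r₀ : ℝ, 0 < r₀ ∧ ∀ τ : ℝ, 0 ≤ τ → c * τ ≤ r₀ →
      ∃ η₁ η₂ : ℝ, 0 < η₁ ∧ η₁ + ε < η₂ ∧
        {η : ℝ | 0 < η ∧ charFun c D (c * τ) η = 0} = {η₁, η₂} ∧
        charFun c D (c * τ) (η₁ + ε) < 0 ∧
        phiUpper η₁ ∈ Gam ∧
        IsQuasiUpper c D (c * τ) (phiUpper η₁) ∧
        (∃ q₀ : ℝ, 0 < q₀ ∧ ∀ q : ℝ, q₀ ≤ q →
          ∃ ξ₁ : ℝ, ξ₁ < 0 ∧ 0 < plateau η₁ ε q ξ₁ ∧ plateau η₁ ε q ξ₁ < 1 ∧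
            IsQuasiLower c D (c * τ) (phiLower η₁ ε q ξ₁) ∧
            ∀ ξ : ℝ, 0 ≤ phiLower η₁ ε q ξ₁ ξ ∧ phiLower η₁ ε q ξ₁ ξ ≤ phiUpper η₁ ξ) ∧
        ∃ φ : ℝ → ℝ, φ ∈ Gam ∧ IsProfileSolution c D (c * τ) φ ∧
          IsPDESolution D τ (fun x t => φ (x + c * t)) := by
  have hpos₀ : 0 < charFun c D 0 ε := by
    by_contra hle
    exact (charFun_neg_of_between hc hD hε.le hεl₁ hl (not_lt.1 hle) hroot₂.le).ne hroot₁
  -- The first bound gives `Δ_r(ε) ≥ Δ_0(ε) - εr > 0`, hence `η₁ > ε` and `η₁ + ε ≤ 2η₁`; the second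
  -- gives `r ≤ 2Dε ≤ 2Dη₁`, needed for the quasi upper solution.
  refine ⟨min (charFun c D 0 ε / (2 * ε)) (2 * D * ε), by positivity, fun τ hτ hle => ?_⟩
  have hr : 0 ≤ c * τ := mul_nonneg hc.le hτ
  have hr₁ : c * τ * (2 * ε) ≤ charFun c D 0 ε :=
    (le_div_iff₀ (by positivity)).1 (hle.trans (min_le_left _ _))
  have hpos : 0 < charFun c D (c * τ) ε := by
    have h := Real.add_one_le_exp (-(ε * (c * τ)))
    have e : charFun c D (c * τ) ε = charFun c D 0 ε - 1 + Real.exp (-(ε * (c * τ))) := by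
      unfold charFun; rw [mul_zero, neg_zero, Real.exp_zero]; ring
    linarith
  obtain ⟨η₁, η₂, hεη, hgap, hset, hneg⟩ :=
    exists_charFun_roots hc hD hroot₁ hroot₂ hε hεl₁ hεl₂ hr hpos
  have hη₁ : 0 < η₁ := hε.trans hεη
  have hroot : charFun c D (c * τ) η₁ = 0 := by
    have : η₁ ∈ {η : ℝ | 0 < η ∧ charFun c D (c * τ) η = 0} := by rw [hset]; exact Or.inl rfl
    exact this.2
  have hrη : c * τ ≤ 2 * D * η₁ := (hle.trans (min_le_right _ _)).trans (by gcongr)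
  obtain ⟨φ, hφ, hsol⟩ := exists_profile hc hD hl₁ hroot₁ hr hη₁
    (by linarith : η₁ < η₁ + ε) (by linarith) hroot hneg
  exact ⟨η₁, η₂, hη₁, hgap, hset, hneg, phiUpper_mem_Gam hη₁,
    isQuasiUpper_phiUpper hη₁ hr hroot hrη,
    exists_isQuasiLower_phiLower hη₁ hε hεη.le hr hroot hneg,
    φ, hφ, hsol, hsol.isPDESolution⟩
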